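/- Let $d\ge 2$. A line transversal to a family $\mathcal F$ of compact convex sets in $\mathbb R^d$ is a line that meets every member of $\mathcal F$; the set of all line transversals to $\mathcal F$ carries the subspace topology from the affine Grassmannian of lines in $\mathbb R^d$. The family $\mathcal F$ pins a line $\ell$ if $\ell$ is an isolated point of this space, and $\mathcal F$ is a minimal pinning of $\ell$ if $\mathcal F$ pins $\ell$ but no proper subfamily of $\mathcal F$ does. Theorem. For every $d\ge 2$ there exist a line $\ell$ in $\mathbb R^d$ and a family $\mathcal F$ of exactly $2d-1$ pairwise disjoint congruent closed balls in $\mathbb R^d$ (balls of one common radius $r>0$) such that $\mathcal F$ is a minimal pinning of $\ell$. -/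

import Mathlib

/-- A line in `ℝ^d`: a nonempty affine subspace whose direction is one-dimensional. -/
@[ext]
structure AffineLine (d : ℕ) where
  /-- The underlying affine subspace. -/
  carrier : AffineSubspace ℝ (EuclideanSpace ℝ (Fin d))
  nonempty : (carrier : Set (EuclideanSpace ℝ (Fin d))).Nonempty
  finrank_direction : Module.finrank ℝ carrier.direction = 1

namespace AffineLine

/-- The line through the point `x.1` with direction vector `x.2 ≠ 0`. -/
noncomputable def through {d : ℕ}
    (x : {x : EuclideanSpace ℝ (Fin d) × EuclideanSpace ℝ (Fin d) // x.2 ≠ 0}) :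
    AffineLine d where
  carrier := AffineSubspace.mk' x.1.1 (Submodule.span ℝ {x.1.2})
  nonempty := ⟨x.1.1, AffineSubspace.self_mem_mk' _ _⟩
  finrank_direction := by
    rw [AffineSubspace.direction_mk']
    exact finrank_span_singleton x.2

/-- Every line is of the form `through x`. -/
theorem through_surjective {d : ℕ} :
    Function.Surjective (through : _ → AffineLine d) := by
  intro l
  obtain ⟨p, hp⟩ := l.nonempty
  obtain ⟨v, hv, hspan⟩ := finrank_eq_one_iff'.1 l.finrank_direction
  refine ⟨⟨(p, (v : EuclideanSpace ℝ (Fin d))), fun h => hv (Subtype.ext h)⟩, ?_⟩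
  apply AffineLine.ext
  have hd : Submodule.span ℝ {(v : EuclideanSpace ℝ (Fin d))} = l.carrier.direction := by
    apply le_antisymm
    · rw [Submodule.span_singleton_le_iff_mem]
      exact v.2
    · intro w hw
      obtain ⟨c, hc⟩ := hspan ⟨w, hw⟩
      exact Submodule.mem_span_singleton.2 ⟨c, congrArg Subtype.val hc⟩
  change AffineSubspace.mk' p (Submodule.span ℝ {(v : EuclideanSpace ℝ (Fin d))}) = _
  rw [hd]
  exact AffineSubspace.mk'_eq hp

/-- The usual topology of the affine Grassmannian of lines in `ℝ^d`: the quotient topology along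
the surjection that sends a point and a nonzero direction vector to the line they determine. -/
noncomputable instance {d : ℕ} : TopologicalSpace (AffineLine d) :=
  TopologicalSpace.coinduced through inferInstance

end AffineLine

/-- The space of transversals to `F`: all lines that meet every member of `F`. -/
def transversals {d : ℕ} (F : Set (Set (EuclideanSpace ℝ (Fin d)))) : Set (AffineLine d) :=
  {l | ∀ B ∈ F, ((l.carrier : Set (EuclideanSpace ℝ (Fin d))) ∩ B).Nonempty}

/-- `F` pins `l`: the line `l` is an isolated point of the space of transversals to `F`. -/
def Pins {d : ℕ} (F : Set (Set (EuclideanSpace ℝ (Fin d)))) (l : AffineLine d) : Prop :=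
  ∃ U : Set (AffineLine d), IsOpen U ∧ U ∩ transversals F = {l}

/-- `F` is a minimal pinning of `l`: it pins `l`, and no proper subset of `F` does. -/
def IsMinimalPinning {d : ℕ} (F : Set (Set (EuclideanSpace ℝ (Fin d)))) (l : AffineLine d) :
    Prop :=
  Pins F l ∧ ∀ G : Set (Set (EuclideanSpace ℝ (Fin d))), G ⊂ F → ¬ Pins G l

/-! ### Lines transverse to the axis, and the quadratic estimate -/

open scoped RealInnerProductSpace
open Filter Topology

/-! Place balls tangent to an axis `ℝ e` at heights `z i` with inward unit normals `u i`. Lines `t ↦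
a + t • (e + b)` with `a, b ⊥ e` form a space of dimension `2d - 2`, and meeting ball `i` means `⟪a
+ z i • b, u i⟫ ≥ 0` up to a quadratic error (`le_inner_of_dist_le`). If the vectors `(u i, z i • u
i)` have a positive linear dependency, summing the conditions cancels the linear terms, and for
small `r` the quadratic ones force `a = b = 0` (`pins_range_closedBall`). If the conditions other
than one can be made strict, the axis moves freely once that ball is dropped
(`not_pins_of_inner_pos`).

Such normals come from signed multiples of `(0, 1, x², …, x^(2n))` at `x = 0, …, 2n + 2`, with `d =
n + 2`. Pairing with `a + x • b` gives an arbitrary polynomial of degree at most `2n + 1`: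
alternating binomial sums supply the dependency, Lagrange interpolation the strict solutions. -/

theorem AffineLine.mem_through {d : ℕ}
    (x : {x : EuclideanSpace ℝ (Fin d) × EuclideanSpace ℝ (Fin d) // x.2 ≠ 0})
    (y : EuclideanSpace ℝ (Fin d)) :
    y ∈ (AffineLine.through x).carrier ↔ ∃ t : ℝ, x.1.1 + t • x.1.2 = y := by
  simp only [AffineLine.through, AffineSubspace.mem_mk', Submodule.mem_span_singleton, vsub_eq_sub,
    eq_sub_iff_add_eq']

theorem AffineLine.through_eq_of_smul {d : ℕ}
    (x y : {x : EuclideanSpace ℝ (Fin d) × EuclideanSpace ℝ (Fin d) // x.2 ≠ 0}) {s k : ℝ}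
    (hk : k ≠ 0) (h1 : x.1.1 = y.1.1 + s • y.1.2) (h2 : x.1.2 = k • y.1.2) :
    AffineLine.through x = AffineLine.through y := by
  apply AffineLine.ext
  ext p
  rw [AffineLine.mem_through, AffineLine.mem_through, h1, h2]
  constructor
  · rintro ⟨t, rfl⟩
    exact ⟨s + t * k, by module⟩
  · rintro ⟨t, rfl⟩
    refine ⟨(t - s) / k, ?_⟩
    rw [smul_smul, div_mul_cancel₀ _ hk]
    module

/-- If the line `t ↦ a + t • (e + b)`, with `a` and `b` orthogonal to the unit vector `e`, meets the
ball of radius `r` that is tangent to the axis `ℝ e` at height `z` with normal `u`, then it satisfies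
the linearised condition at height `z` up to a quadratic error. -/
theorem le_inner_of_dist_le {E : Type*} [NormedAddCommGroup E] [InnerProductSpace ℝ E]
    {e u a b : E} {r z t : ℝ} (he : ‖e‖ = 1) (hu : ‖u‖ = 1) (hue : ⟪e, u⟫ = 0)
    (ha : ⟪e, a⟫ = 0) (hb : ⟪e, b⟫ = 0)
    (h : ‖a + t • (e + b) - (z • e + r • u)‖ ≤ r) :
    ‖a + z • b‖ ^ 2 / 2 - 2 * r ^ 2 * ‖b‖ ^ 2 ≤ 2 * r * ⟪a + z • b, u⟫ := by
  set q := a + z • b with hq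
  set s := t - z with hs
  set y := q + s • b with hy
  have hqe : ⟪e, q⟫ = 0 := by simp [hq, inner_add_right, inner_smul_right, ha, hb]
  have hye : ⟪e, y - r • u⟫ = 0 := by
    simp [hy, inner_add_right, inner_sub_right, inner_smul_right, hqe, hb, hue]
  have h1 : a + t • (e + b) - (z • e + r • u) = s • e + (y - r • u) := by
    simp only [hy, hq, hs]; module
  have h2 : s ^ 2 + ‖y - r • u‖ ^ 2 ≤ r ^ 2 := by
    have h3 : ‖s • e + (y - r • u)‖ ^ 2 = s ^ 2 + ‖y - r • u‖ ^ 2 := by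
      rw [norm_add_sq_real, norm_smul, he, inner_smul_left, hye]
      simp
    rw [← h3, ← h1]
    gcongr
  have h4 : ‖y - r • u‖ ^ 2 = ‖y‖ ^ 2 - 2 * r * (⟪q, u⟫ + s * ⟪b, u⟫) + r ^ 2 := by
    rw [norm_sub_sq_real, norm_smul, hu, inner_smul_right, mul_one, Real.norm_eq_abs, sq_abs]
    simp only [hy, inner_add_left, inner_smul_left, conj_trivial]
    ring
  have h5 : ⟪b, u⟫ ^ 2 ≤ ‖b‖ ^ 2 := by
    have := abs_real_inner_le_norm b u
    rw [hu, mul_one] at this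
    rw [← sq_abs]
    gcongr
  have h6 : ‖q‖ ^ 2 ≤ 2 * ‖y‖ ^ 2 + 2 * s ^ 2 * ‖b‖ ^ 2 := by
    have h7 : q = y - s • b := by simp [hy]
    have h8 := parallelogram_law_with_norm ℝ y (s • b)
    rw [norm_smul, Real.norm_eq_abs] at h8
    rw [h7]
    nlinarith [sq_nonneg ‖y + s • b‖, sq_abs s]
  have h9 : s ^ 2 ≤ r ^ 2 := by nlinarith [sq_nonneg ‖y - r • u‖]
  -- The error `2 * r ^ 2 * ‖b‖ ^ 2` is one `r ^ 2 * ‖b‖ ^ 2` from completing the square in `s` and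
  -- one from `s ^ 2 ≤ r ^ 2` in `h6`.
  nlinarith [sq_nonneg (s - r * ⟪b, u⟫), mul_le_mul_of_nonneg_right h9 (sq_nonneg ‖b‖),
    mul_le_mul_of_nonneg_left h5 (sq_nonneg r)]

theorem AffineLine.isOpen_setOf_inner_ne_zero {d : ℕ} (e : EuclideanSpace ℝ (Fin d)) :
    IsOpen {l : AffineLine d | ∃ v ∈ l.carrier.direction, ⟪e, v⟫ ≠ 0} := by
  rw [isOpen_coinduced]
  have : AffineLine.through ⁻¹' {l : AffineLine d | ∃ v ∈ l.carrier.direction, ⟪e, v⟫ ≠ 0} =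
      {x | ⟪e, x.1.2⟫ ≠ 0} := by
    ext x
    simp only [Set.mem_preimage, Set.mem_ofPred_eq, AffineLine.through,
      AffineSubspace.direction_mk']
    constructor
    · rintro ⟨v, hv, h⟩ h0
      obtain ⟨k, rfl⟩ := Submodule.mem_span_singleton.1 hv
      exact h (by rw [inner_smul_right, h0, mul_zero])
    · exact fun h => ⟨_, Submodule.mem_span_singleton_self _, h⟩
  rw [this]
  exact isOpen_ne_fun (by fun_prop) continuous_const

/-! ### Pinning by tangent balls -/

section TangentBalls

variable {d : ℕ} {ι : Type*} {e : EuclideanSpace ℝ (Fin d)}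
  {u : ι → EuclideanSpace ℝ (Fin d)} {w z : ι → ℝ} {r : ℝ}

/-- Balanced tangent balls of sufficiently small radius pin their common tangent line. -/
theorem pins_range_closedBall [Fintype ι] (hr : 0 < r) (he : ‖e‖ = 1) (he0 : e ≠ 0) (hu : ∀ i, ‖u i‖ = 1)
    (hue : ∀ i, ⟪e, u i⟫ = 0) (hw : ∀ i, 0 < w i) (h0 : ∑ i, w i • u i = 0)
    (h1 : ∑ i, (w i * z i) • u i = 0) {i₀ i₁ : ι} (hz : z i₁ = z i₀ + 1)
    (hr₀ : 8 * r ^ 2 * ∑ i, w i < w i₀) (hr₁ : 8 * r ^ 2 * ∑ i, w i < w i₁) :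
    Pins (Set.range fun i => Metric.closedBall (z i • e + r • u i) r)
      (AffineLine.through ⟨(0, e), he0⟩) := by
  classical
  refine ⟨_, AffineLine.isOpen_setOf_inner_ne_zero e, Set.Subset.antisymm ?_ ?_⟩
  · rintro l ⟨⟨v, hv, hev⟩, hl⟩
    obtain ⟨⟨⟨p, v'⟩, hv'⟩, rfl⟩ := AffineLine.through_surjective l
    simp only [AffineLine.through, AffineSubspace.direction_mk'] at hv
    obtain ⟨k', rfl⟩ := Submodule.mem_span_singleton.1 hv
    have hk : ⟪e, v'⟫ ≠ 0 := fun h => hev (by rw [inner_smul_right, h, mul_zero])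
    set k := ⟪e, v'⟫ with hkdef
    -- Rescale the direction to `e + b` and slide the base point to the hyperplane `e⊥`.
    set b := k⁻¹ • v' - e with hbdef
    set a := p - ⟪e, p⟫ • (e + b) with hadef
    have hee : ⟪e, e⟫ = 1 := by rw [real_inner_self_eq_norm_sq, he]; norm_num
    have hb : ⟪e, b⟫ = 0 := by
      rw [hbdef, inner_sub_right, inner_smul_right, ← hkdef, inv_mul_cancel₀ hk, hee, sub_self]
    have ha : ⟪e, a⟫ = 0 := by
      rw [hadef, inner_sub_right, inner_smul_right, inner_add_right, hb, hee]; ring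
    have hv'b : v' = k • (e + b) := by
      rw [hbdef, add_sub_cancel, smul_smul, mul_inv_cancel₀ hk, one_smul]
    have hpa : p = a + ⟪e, p⟫ • (e + b) := by rw [hadef, sub_add_cancel]
    have key : ∀ i, ‖a + z i • b‖ ^ 2 / 2 - 2 * r ^ 2 * ‖b‖ ^ 2 ≤
        2 * r * ⟪a + z i • b, u i⟫ := by
      intro i
      obtain ⟨x, hx, hxB⟩ := hl _ ⟨i, rfl⟩
      obtain ⟨t, rfl⟩ := (AffineLine.mem_through _ _).1 hx
      rw [mem_closedBall_iff_norm] at hxB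
      refine le_inner_of_dist_le (t := ⟪e, p⟫ + t * k) he (hu i) (hue i) ha hb ?_
      have hpt : a + (⟪e, p⟫ + t * k) • (e + b) = p + t • v' := by
        rw [add_smul, ← add_assoc, ← hpa, mul_smul, ← hv'b]
      rw [hpt]
      exact hxB
    have hsum : ∑ i, w i * ⟪a + z i • b, u i⟫ = 0 := by
      have e1 : ∑ i, w i * ⟪a + z i • b, u i⟫ =
          ⟪a, ∑ i, w i • u i⟫ + ⟪b, ∑ i, (w i * z i) • u i⟫ := by
        rw [inner_sum, inner_sum, ← Finset.sum_add_distrib]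
        refine Finset.sum_congr rfl fun i _ => ?_
        rw [inner_add_left, inner_smul_left, inner_smul_right, inner_smul_right]
        simp only [conj_trivial]
        ring
      rw [e1, h0, h1]
      simp
    have hle : ∑ i, w i * ‖a + z i • b‖ ^ 2 ≤ 4 * r ^ 2 * (∑ i, w i) * ‖b‖ ^ 2 := by
      have := Finset.sum_le_sum fun i (_ : i ∈ Finset.univ) =>
        mul_le_mul_of_nonneg_left (key i) (hw i).le
      have e2 : ∑ i, w i * (2 * r * ⟪a + z i • b, u i⟫) = 0 := by
        rw [← mul_zero (2 * r), ← hsum, Finset.mul_sum]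
        exact Finset.sum_congr rfl fun i _ => by ring
      have e3 : ∑ i, w i * (‖a + z i • b‖ ^ 2 / 2 - 2 * r ^ 2 * ‖b‖ ^ 2) =
          (∑ i, w i * ‖a + z i • b‖ ^ 2) / 2 - 2 * r ^ 2 * (∑ i, w i) * ‖b‖ ^ 2 := by
        rw [Finset.sum_div, Finset.mul_sum, Finset.sum_mul, ← Finset.sum_sub_distrib]
        exact Finset.sum_congr rfl fun i _ => by ring
      linarith
    have hne : i₀ ≠ i₁ := by rintro rfl; linarith
    have hge : w i₀ * ‖a + z i₀ • b‖ ^ 2 + w i₁ * ‖a + z i₁ • b‖ ^ 2 ≤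
        ∑ i, w i * ‖a + z i • b‖ ^ 2 := by
      rw [← Finset.sum_pair (f := fun i => w i * ‖a + z i • b‖ ^ 2) hne]
      exact Finset.sum_le_sum_of_subset_of_nonneg (Finset.subset_univ _)
        fun i _ _ => mul_nonneg (hw i).le (sq_nonneg _)
    -- Heights one apart make `b` the difference of the two displacements, so two terms of the sum
    -- absorb the error.
    have hb2 : ‖b‖ ^ 2 ≤ 2 * ‖a + z i₀ • b‖ ^ 2 + 2 * ‖a + z i₁ • b‖ ^ 2 := by
      have h8 := parallelogram_law_with_norm ℝ (a + z i₁ • b) (a + z i₀ • b)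
      have e4 : (a + z i₁ • b) - (a + z i₀ • b) = b := by rw [hz]; module
      rw [e4] at h8
      nlinarith [sq_nonneg ‖(a + z i₁ • b) + (a + z i₀ • b)‖]
    have hsmall : ∀ i, 8 * r ^ 2 * ∑ i, w i < w i → 0 ≤ ‖a + z i • b‖ ^ 2 *
      (w i - 8 * r ^ 2 * ∑ i, w i) := fun i h => mul_nonneg (sq_nonneg _) (by linarith)
    have hS : 0 ≤ r ^ 2 * ∑ i, w i := 
      mul_nonneg (sq_nonneg _) (Finset.sum_nonneg fun i _ => (hw i).le)
    have hz0 : ∀ {x : EuclideanSpace ℝ (Fin d)} {c : ℝ}, 0 < c → c * ‖x‖ ^ 2 ≤ 0 → x = 0 := by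
      intro x c hc h
      have : ‖x‖ ^ 2 ≤ 0 := nonpos_of_mul_nonpos_right h hc
      exact norm_eq_zero.1 (pow_eq_zero_iff two_ne_zero |>.1 (le_antisymm this (sq_nonneg _)))
    have hmul := mul_le_mul_of_nonneg_left hb2 hS
    have hq₀ : a + z i₀ • b = 0 := by
      refine hz0 (c := w i₀ - 8 * r ^ 2 * ∑ i, w i) (by linarith) ?_
      nlinarith [hsmall i₁ hr₁]
    have hq₁ : a + z i₁ • b = 0 := by
      refine hz0 (c := w i₁ - 8 * r ^ 2 * ∑ i, w i) (by linarith) ?_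
      nlinarith [hsmall i₀ hr₀]
    have hb0 : b = 0 := by
      rw [hq₀, hq₁] at hb2
      exact hz0 one_pos (by simpa using hb2)
    have ha0 : a = 0 := by simpa [hb0] using hq₀
    rw [ha0, hb0] at hpa
    rw [hb0] at hv'b
    refine AffineLine.through_eq_of_smul _ _ (s := ⟪e, p⟫) (k := k) hk ?_ ?_
    · simpa using hpa
    · simpa using hv'b
  · rintro l rfl
    refine ⟨⟨e, ?_, ?_⟩, ?_⟩
    · simp only [AffineLine.through, AffineSubspace.direction_mk']
      exact Submodule.mem_span_singleton_self _
    · rw [real_inner_self_eq_norm_sq, he]; norm_num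
    · rintro _ ⟨i, rfl⟩
      refine ⟨z i • e, (AffineLine.mem_through _ _).2 ⟨z i, by simp⟩, ?_⟩
      rw [mem_closedBall_iff_norm]
      simp [norm_smul, hu, abs_of_pos hr]

/-- Tangent balls do not pin their common tangent line if there is a first-order motion of the line
that moves it towards the inside of every ball. -/
theorem not_pins_of_inner_pos [Finite ι] (hr : 0 < r) (he : ‖e‖ = 1) (he0 : e ≠ 0) (hu : ∀ i, ‖u i‖ = 1)
    (hue : ∀ i, ⟪e, u i⟫ = 0) {G : Set (Set (EuclideanSpace ℝ (Fin d)))} {i₀ : ι}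
    (hG : ∀ B ∈ G, ∃ i ≠ i₀, B = Metric.closedBall (z i • e + r • u i) r) {i₁ : ι} (hi : i₁ ≠ i₀)
    {a b : EuclideanSpace ℝ (Fin d)} (hb : ⟪e, b⟫ = 0)
    (hab : ∀ i ≠ i₀, 0 < ⟪a + z i • b, u i⟫) :
    ¬ Pins G (AffineLine.through ⟨(0, e), he0⟩) := by
  rintro ⟨U, hU, hUG⟩
  have hee : ⟪e, e⟫ = 1 := by rw [real_inner_self_eq_norm_sq, he]; norm_num
  have hne : ∀ t : ℝ, e + t • b ≠ 0 := by
    intro t h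
    have : ⟪e, e + t • b⟫ = 1 := by rw [inner_add_right, inner_smul_right, hb, hee]; ring
    rw [h, inner_zero_right] at this
    exact zero_ne_one this
  let f : ℝ → AffineLine d := fun t => AffineLine.through ⟨(t • a, e + t • b), hne t⟩
  have hf : Continuous f := by
    have hg : Continuous fun t : ℝ => (t • a, e + t • b) := by fun_prop
    have hthrough : Continuous (AffineLine.through (d := d)) := continuous_coinduced_rng
    exact hthrough.comp (hg.subtype_mk hne)
  have hf0 : f 0 = AffineLine.through ⟨(0, e), he0⟩ := by
    simp [f]
  have hU0 : f 0 ∈ U := by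
    have : f 0 ∈ U ∩ transversals G := by rw [hUG, hf0]; rfl
    exact this.1
  have hev1 : ∀ᶠ t in 𝓝[>] (0 : ℝ), f t ∈ U :=
    (hf.continuousAt.eventually (hU.mem_nhds hU0)).filter_mono nhdsWithin_le_nhds
  -- For `t > 0` this is, after division by `t`, the condition that the moved line's point at height
  -- `z i` lies in ball `i`.
  have hev2 : ∀ i ≠ i₀, ∀ᶠ t in 𝓝[>] (0 : ℝ),
      t * ‖a + z i • b‖ ^ 2 ≤ 2 * r * ⟪a + z i • b, u i⟫ := by
    intro i hii
    have hc : Continuous fun t : ℝ => t * ‖a + z i • b‖ ^ 2 := by fun_prop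
    have hp : (0 : ℝ) * ‖a + z i • b‖ ^ 2 < 2 * r * ⟪a + z i • b, u i⟫ := by
      have := hab i hii
      rw [zero_mul]; positivity
    exact ((hc.continuousAt.eventually (gt_mem_nhds hp)).filter_mono nhdsWithin_le_nhds).mono
      fun t ht => le_of_lt ht
  have hev2' : ∀ᶠ t in 𝓝[>] (0 : ℝ), ∀ i, i ≠ i₀ →
      t * ‖a + z i • b‖ ^ 2 ≤ 2 * r * ⟪a + z i • b, u i⟫ :=
    eventually_all.2 fun i => by
      by_cases h : i = i₀
      · exact Eventually.of_forall fun t h' => absurd h h'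
      · exact (hev2 i h).mono fun t ht _ => ht
  obtain ⟨t, ⟨htU, ht⟩, htpos⟩ := ((hev1.and hev2').and self_mem_nhdsWithin).exists
  have htpos : 0 < t := htpos
  have hmem : f t ∈ U ∩ transversals G := by
    refine ⟨htU, fun B hB => ?_⟩
    obtain ⟨i, hii, rfl⟩ := hG B hB
    refine ⟨_, (AffineLine.mem_through _ _).2 ⟨z i, rfl⟩, ?_⟩
    rw [mem_closedBall_iff_norm]
    have e1 : t • a + z i • (e + t • b) - (z i • e + r • u i) =
        t • (a + z i • b) - r • u i := by module
    simp only
    rw [e1]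
    refine le_of_sq_le_sq ?_ hr.le
    rw [norm_sub_sq_real, norm_smul, norm_smul, hu, inner_smul_left, inner_smul_right,
      Real.norm_eq_abs, Real.norm_eq_abs, mul_pow, mul_pow, sq_abs, sq_abs]
    simp only [conj_trivial]
    nlinarith [mul_le_mul_of_nonneg_left (ht i hii) htpos.le]
  rw [hUG] at hmem
  have hx : t • a + z i₁ • (e + t • b) ∈ (f t).carrier :=
    (AffineLine.mem_through _ _).2 ⟨z i₁, rfl⟩
  rw [Set.mem_singleton_iff.1 hmem] at hx
  obtain ⟨s, hs⟩ := (AffineLine.mem_through _ _).1 hx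
  -- The moved line is not the axis: it has a point with nonzero `u i₁` component.
  have h1 : ⟪t • a + z i₁ • (e + t • b), u i₁⟫ = t * ⟪a + z i₁ • b, u i₁⟫ := by
    simp only [inner_add_left, inner_smul_left, conj_trivial, hue]
    ring
  rw [← hs] at h1
  simp only [zero_add, inner_smul_left, hue, mul_zero] at h1
  exact absurd h1 (mul_pos htpos (hab i₁ hi)).ne

/-- Projecting to the axis already puts the centres at least `1 > 2 * r` apart. -/
theorem pairwise_disjoint_closedBall (he : ‖e‖ = 1) (hue : ∀ i, ⟪e, u i⟫ = 0) (hr : 2 * r < 1)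
    (hz : Pairwise fun i j => 1 ≤ |z i - z j|) :
    Pairwise fun i j => Disjoint (Metric.closedBall (z i • e + r • u i) r)
      (Metric.closedBall (z j • e + r • u j) r) := by
  intro i j hij
  apply Metric.closedBall_disjoint_closedBall
  have hee : ⟪e, e⟫ = 1 := by rw [real_inner_self_eq_norm_sq, he]; norm_num
  have h1 : ⟪e, (z i • e + r • u i) - (z j • e + r • u j)⟫ = z i - z j := by
    simp only [inner_sub_right, inner_add_right, inner_smul_right, hue, hee]
    ring
  have h2 := abs_real_inner_le_norm e ((z i • e + r • u i) - (z j • e + r • u j))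
  rw [h1, he, one_mul, ← dist_eq_norm] at h2
  linarith [hz hij]

/-- A balanced system of unit normals `u i` at heights `z i` along the axis `ℝ e`, such that the
first-order conditions of any proper subsystem can be satisfied strictly, gives a minimal pinning
of the axis by tangent congruent balls. -/
theorem exists_isMinimalPinning_closedBall [Fintype ι] (he : ‖e‖ = 1) (hu : ∀ i, ‖u i‖ = 1)
    (hue : ∀ i, ⟪e, u i⟫ = 0) (hw : ∀ i, 0 < w i) (h0 : ∑ i, w i • u i = 0)
    (h1 : ∑ i, (w i * z i) • u i = 0) {i₀ i₁ : ι} (hz₁ : z i₁ = z i₀ + 1)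
    (hz : Pairwise fun i j => 1 ≤ |z i - z j|)
    (hab : ∀ i, ∃ a b : EuclideanSpace ℝ (Fin d), ⟪e, b⟫ = 0 ∧
      ∀ j ≠ i, 0 < ⟪a + z j • b, u j⟫) :
    ∃ (F : Set (Set (EuclideanSpace ℝ (Fin d)))) (l : AffineLine d) (r : ℝ),
      0 < r ∧
      (∀ B ∈ F, ∃ c : EuclideanSpace ℝ (Fin d), B = Metric.closedBall c r) ∧
      F.ncard = Fintype.card ι ∧
      F.PairwiseDisjoint id ∧
      IsMinimalPinning F l := by
  have he0 : e ≠ 0 := by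
    rintro rfl
    simp at he
  obtain ⟨r, ⟨⟨hr₀, hr₁⟩, hr2⟩, hr⟩ : ∃ r : ℝ, ((8 * r ^ 2 * ∑ i, w i < w i₀ ∧
      8 * r ^ 2 * ∑ i, w i < w i₁) ∧ 2 * r < 1) ∧ 0 < r := by
    have hlim : ∀ {g : ℝ → ℝ} {c : ℝ}, Continuous g → g 0 < c → ∀ᶠ r in 𝓝[>] (0 : ℝ), g r < c :=
      fun hg h => (hg.continuousAt.eventually (gt_mem_nhds h)).filter_mono nhdsWithin_le_nhds
    have ev : ∀ i, ∀ᶠ r in 𝓝[>] (0 : ℝ), 8 * r ^ 2 * ∑ i, w i < w i := fun i =>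
      hlim (g := fun r => 8 * r ^ 2 * ∑ i, w i) (by fun_prop) (by simpa using hw i)
    have ev2 : ∀ᶠ r in 𝓝[>] (0 : ℝ), 2 * r < 1 :=
      hlim (g := fun r => 2 * r) (by fun_prop) (by norm_num)
    exact ((((ev i₀).and (ev i₁)).and ev2).and self_mem_nhdsWithin).exists
  have hdisj := pairwise_disjoint_closedBall he hue hr2 hz
  have hinj : Function.Injective fun i => Metric.closedBall (z i • e + r • u i) r := by
    intro i j hij
    by_contra hne
    have h : Disjoint (Metric.closedBall (z i • e + r • u i) r)
        (Metric.closedBall (z j • e + r • u j) r) := hdisj hne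
    simp only at hij
    rw [hij, disjoint_self] at h
    exact (Metric.nonempty_closedBall.2 hr.le).ne_empty h
  refine ⟨Set.range fun i => Metric.closedBall (z i • e + r • u i) r,
    AffineLine.through ⟨(0, e), he0⟩, r, hr, ?_, ?_, ?_,
    pins_range_closedBall hr he he0 hu hue hw h0 h1 hz₁ hr₀ hr₁, ?_⟩
  · rintro _ ⟨i, rfl⟩
    exact ⟨_, rfl⟩
  · rw [← Set.image_univ, Set.ncard_image_of_injective _ hinj, Set.ncard_univ,
      Nat.card_eq_fintype_card]
  · rintro _ ⟨i, rfl⟩ _ ⟨j, rfl⟩ hne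
    exact hdisj fun h => hne (by rw [h])
  · intro G hG
    obtain ⟨_, ⟨i, rfl⟩, hi⟩ := Set.exists_of_ssubset hG
    obtain ⟨a, b, hb, hpos⟩ := hab i
    have hne : i₀ ≠ i₁ := by rintro rfl; linarith
    obtain ⟨j, hj⟩ : ∃ j, j ≠ i := by
      by_cases h : i₀ = i
      · exact ⟨i₁, fun h' => hne (h.trans h'.symm)⟩
      · exact ⟨i₀, h⟩
    refine not_pins_of_inner_pos hr he he0 hu hue (i₀ := i) ?_ hj hb hpos
    intro B hB
    obtain ⟨j, rfl⟩ := hG.1 hB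
    exact ⟨j, fun h => hi (h ▸ hB), rfl⟩

end TangentBalls

/-! ### Normals from even powers -/

theorem Finset.sum_range_two_mul_eq {M : Type*} [AddCommMonoid M] (f : ℕ → M) (n : ℕ) :
    ∑ m ∈ Finset.range (2 * n), f m = ∑ k ∈ Finset.range n, (f (2 * k) + f (2 * k + 1)) := by
  induction n with
  | zero => simp
  | succ n ih =>
    rw [Nat.mul_succ, Finset.sum_range_succ, Finset.sum_range_succ, ih, Finset.sum_range_succ,
      add_assoc]

/-- Up to the sign `(-1) ^ n`, this is the `n`-th forward difference at `0` of a monomial of degree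
below `n`. -/
theorem sum_alternating_choose_mul_pow {n m : ℕ} (h : m < n) :
    ∑ j : Fin (n + 1), ((-1 : ℝ) ^ (j : ℕ) * (n.choose j)) * (j : ℝ) ^ m = 0 := by
  rw [Fin.sum_univ_eq_sum_range
    (fun j : ℕ => ((-1 : ℝ) ^ j * (n.choose j)) * (j : ℝ) ^ m) (n + 1)]
  have h0 := congrFun (fwdDiff_iter_pow_eq_zero_of_lt (R := ℝ) h) 0
  rw [fwdDiff_iter_eq_sum_shift] at h0
  have h1 := congrArg (fun x => (-1 : ℝ) ^ n * x) h0
  simp only [Pi.zero_apply, mul_zero, Finset.mul_sum] at h1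
  rw [← h1]
  refine Finset.sum_congr rfl fun j hj => ?_
  have hjn : j ≤ n := by simpa [Nat.lt_succ_iff] using hj
  obtain ⟨k, rfl⟩ := Nat.exists_eq_add_of_le hjn
  have hk : ((-1 : ℝ) ^ k) * (-1) ^ k = 1 := by rw [← mul_pow]; norm_num
  simp only [Nat.add_sub_cancel_left, zsmul_eq_mul, nsmul_eq_mul, mul_one, zero_add]
  push_cast
  rw [pow_add]
  linear_combination (-((-1 : ℝ) ^ j * ((j + k).choose j) * (j : ℝ) ^ m)) * hk

/-- The vector `(0, 1, x ^ 2, …, x ^ (2 * n))`. -/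
noncomputable def evenPowers (n : ℕ) (x : ℝ) : EuclideanSpace ℝ (Fin (n + 2)) :=
  WithLp.toLp 2 (Fin.cons 0 fun k : Fin (n + 1) => x ^ (2 * (k : ℕ)))

/-- The offset supplies the even coefficients of a polynomial in `x`, the slope the odd ones. -/
theorem inner_evenPowers (n : ℕ) (x : ℝ) (a b : ℕ → ℝ) :
    ⟪(WithLp.toLp 2 (Fin.cons 0 fun k : Fin (n + 1) => a k) : EuclideanSpace ℝ (Fin (n + 2))) +
      x • WithLp.toLp 2 (Fin.cons 0 fun k : Fin (n + 1) => b k), evenPowers n x⟫ =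
      ∑ k ∈ Finset.range (n + 1), (a k * x ^ (2 * k) + b k * x ^ (2 * k + 1)) := by
  rw [Finset.sum_range (n := n + 1), PiLp.inner_apply, Fin.sum_univ_succ]
  simp only [evenPowers, PiLp.add_apply, PiLp.smul_apply, Fin.cons_zero, Fin.cons_succ,
    smul_eq_mul, RCLike.inner_apply, conj_trivial, zero_mul, zero_add]
  refine Finset.sum_congr rfl fun k _ => ?_
  ring

theorem theorem2 (d : ℕ) (hd : 2 ≤ d) :
    ∃ (F : Set (Set (EuclideanSpace ℝ (Fin d)))) (l : AffineLine d) (r : ℝ),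
      0 < r ∧
      (∀ B ∈ F, ∃ c : EuclideanSpace ℝ (Fin d), B = Metric.closedBall c r) ∧
      F.ncard = 2 * d - 1 ∧
      F.PairwiseDisjoint id ∧
      IsMinimalPinning F l := by
  obtain ⟨n, rfl⟩ : ∃ n, d = n + 2 := ⟨d - 2, by omega⟩
  let c : Fin (2 * n + 2 + 1) → ℝ := fun j => (-1) ^ (j : ℕ) * ((2 * n + 2).choose j)
  let z : Fin (2 * n + 2 + 1) → ℝ := fun j => (j : ℕ)
  let v : Fin (2 * n + 2 + 1) → EuclideanSpace ℝ (Fin (n + 2)) := fun j => c j • evenPowers n (z j)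
  have hc : ∀ j, c j ≠ 0 := fun j =>
    mul_ne_zero (pow_ne_zero _ (by norm_num))
      (Nat.cast_ne_zero.2 (Nat.choose_pos (by omega)).ne')
  have hzinj : Function.Injective z := fun i j h => Fin.ext (Nat.cast_injective h)
  have hv : ∀ j, v j ≠ 0 := by
    intro j h
    have := congrArg (fun x => x (1 : Fin (n + 2))) h
    have h1 : (1 : Fin (n + 2)) = Fin.succ 0 := rfl
    simp only [v, evenPowers, PiLp.smul_apply, h1, Fin.cons_succ, PiLp.zero_apply] at this
    simp [hc] at this
  have hwu : ∀ j, ‖v j‖ • (‖v j‖⁻¹ • v j) = v j := fun j => by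
    rw [smul_smul, mul_inv_cancel₀ (norm_ne_zero_iff.2 (hv j)), one_smul]
  have hsum : ∀ s < 2, ∑ j, (z j ^ s) • v j = 0 := by
    intro s hs
    ext k
    simp only [WithLp.ofLp_sum, Finset.sum_apply, PiLp.smul_apply, PiLp.zero_apply, v, evenPowers,
      smul_eq_mul]
    refine Fin.cases (by simp) (fun k => ?_) k
    -- Since `s ≤ 1` and `k ≤ n`, the exponent is at most `2n + 1`.
    rw [← sum_alternating_choose_mul_pow (n := 2 * n + 2) (m := s + 2 * k) (by omega)]
    refine Finset.sum_congr rfl fun j _ => ?_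
    simp only [Fin.cons_succ, c, z]
    ring
  have hcard : 2 * (n + 2) - 1 = Fintype.card (Fin (2 * n + 2 + 1)) := by
    rw [Fintype.card_fin]; omega
  rw [hcard]
  have hcons : ∀ y : Fin (n + 1) → ℝ, ⟪(EuclideanSpace.single 0 1 : EuclideanSpace ℝ (Fin (n + 2))),
      WithLp.toLp 2 (Fin.cons 0 y)⟫ = 0 := by
    intro y
    simp [EuclideanSpace.inner_single_left]
  refine exists_isMinimalPinning_closedBall (e := EuclideanSpace.single 0 1)
    (u := fun j => ‖v j‖⁻¹ • v j) (w := fun j => ‖v j‖) (z := z) (i₀ := 0) (i₁ := 1)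
    (by simp) ?_ ?_ ?_ ?_ ?_ ?_ ?_ ?_
  · intro j
    rw [norm_smul, norm_inv, norm_norm, inv_mul_cancel₀ (norm_ne_zero_iff.2 (hv j))]
  · intro j
    rw [inner_smul_right, inner_smul_right, evenPowers, hcons, mul_zero, mul_zero]
  · exact fun j => norm_pos_iff.2 (hv j)
  · simpa only [hwu, pow_zero, one_smul] using hsum 0 two_pos
  · rw [← hsum 1 one_lt_two]
    refine Finset.sum_congr rfl fun j _ => ?_
    rw [pow_one, mul_comm, mul_smul, hwu]
  · simp [z]
  · intro i j hij
    have : ((i : ℕ) : ℤ) - (j : ℕ) ≠ 0 := fun h => hij (Fin.ext (by omega))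
    have := Int.one_le_abs this
    simp only [z]
    exact_mod_cast this
  · intro i
    -- The remaining `2n + 2` nodes leave degree at most `2n + 1`; the value `(c j)⁻¹` cancels the
    -- sign of `c j` in the normal.
    let P := Lagrange.interpolate (Finset.univ.erase i) z fun j => (c j)⁻¹
    have hdeg : P.degree < (2 * (n + 1) : ℕ) := by
      have := Lagrange.degree_interpolate_lt (s := Finset.univ.erase i) (v := z)
        (fun j => (c j)⁻¹) hzinj.injOn
      rwa [Finset.card_erase_of_mem (Finset.mem_univ i), Finset.card_univ, Fintype.card_fin] at this
    refine ⟨WithLp.toLp 2 (Fin.cons 0 fun k : Fin (n + 1) => P.coeff (2 * k)),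
      WithLp.toLp 2 (Fin.cons 0 fun k : Fin (n + 1) => P.coeff (2 * k + 1)), hcons _, ?_⟩
    intro j hj
    have hP : P.eval (z j) = (c j)⁻¹ :=
      Lagrange.eval_interpolate_at_node _ hzinj.injOn (by simpa using hj)
    have hnat : P.natDegree < 2 * (n + 1) := by
      by_cases h : P = 0
      · rw [h]; simp
      · exact (Polynomial.natDegree_lt_iff_degree_lt h).2 hdeg
    rw [Polynomial.eval_eq_sum_range' hnat, Finset.sum_range_two_mul_eq] at hP
    rw [inner_smul_right, inner_smul_right,
      inner_evenPowers n (z j) (fun k => P.coeff (2 * k)) (fun k => P.coeff (2 * k + 1)), hP,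
      mul_inv_cancel₀ (hc j), mul_one]
    exact inv_pos.2 (norm_pos_iff.2 (hv j))
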